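/- Let $Q_1,Q_2,Q_3\in\mathbb R[u,v,w]$ be quadratic forms such that the plane quartic curve $$\Delta=(Q_1Q_3-Q_2^2=0)\subset\mathbb P^2_{\mathbb R}$$ is smooth. Let $Y$ and $Y^-$ be the double covers of $\mathbb P^1_{[t_0:t_1]}\times\mathbb P^2_{[u:v:w]}$ over $\mathbb R$ given by $$Y:\ z^2=t_0^2Q_1+2t_0t_1Q_2+t_1^2Q_3,\qquad Y^-:\ z^2=-t_0^2Q_1+2t_0t_1Q_2-t_1^2Q_3,$$ where $z$ has bidegree $(1,1)$. (These are the threefolds $Y_{\tilde\Delta/\Delta}$ and $Y_{\tilde\Delta^- /\Delta}$ associated to the étale double cover $\tilde\Delta=(Q_1-r^2=Q_2-rs=Q_3-s^2=0)\to\Delta$ and to its quadratic twist $\tilde\Delta^-=(Q_1+r^2=Q_2-rs=Q_3+s^2=0)\to\Delta$.) If $\Delta(\mathbb R)\neq\emptyset$, then at least one of $Y$ and $Y^-$ is rational over $\mathbb R$, that is, birational over $\mathbb R$ to $\mathbb P^3_{\mathbb R}$. -/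

import Mathlib

open MvPolynomial AlgebraicGeometry CategoryTheory

noncomputable section

namespace DoubleCover

/-! ### Two operations on graded algebras -/

section Graded

variable {R A : Type*} [CommRing R] [CommRing A] [Algebra R A]

/-- A spanning family of submodules is an internal direct sum as soon as it is separated by a
family of additive maps. -/
theorem isInternal_of_separated {ι M P : Type*} [DecidableEq ι] [AddCommGroup M] [Module R M]
    [AddCommGroup P] (N : ι → Submodule R M) (p : ι → M →+ P)
    (h_same : ∀ i, ∀ x ∈ N i, p i x = 0 → x = 0)
    (h_ne : ∀ i j, j ≠ i → ∀ x ∈ N j, p i x = 0)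
    (h_span : ⨆ i, N i = ⊤) : DirectSum.IsInternal N := by
  classical
  refine DirectSum.isInternal_submodule_of_iSupIndep_of_iSup_eq_top ?_ h_span
  intro i
  rw [disjoint_iff, eq_bot_iff]
  rintro x ⟨hx, hx'⟩
  refine h_same i x hx ?_
  refine Submodule.iSup_induction (motive := fun y => p i y = 0) _ hx' ?_ (map_zero _) ?_
  · intro j y hy
    by_cases hj : j = i
    · subst hj
      have : y = 0 := by simpa using hy
      simp [this]
    · exact h_ne i j hj y (by simpa [hj] using hy)
  · intro y z hy hz
    rw [map_add, hy, hz, add_zero]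

/-- The graded pieces of the quotient `A ⧸ I` of a graded algebra: the images of those of `A`. -/
def quotientGrading {ι : Type*} (𝒜 : ι → Submodule R A) (I : Ideal A) (i : ι) :
    Submodule R (A ⧸ I) :=
  (𝒜 i).map (Ideal.Quotient.mkₐ R I).toLinearMap

instance quotientGrading_gradedMonoid {ι : Type*} [AddMonoid ι] (𝒜 : ι → Submodule R A)
    [SetLike.GradedMonoid 𝒜] (I : Ideal A) :
    SetLike.GradedMonoid (quotientGrading 𝒜 I) where
  one_mem := ⟨1, SetLike.GradedOne.one_mem, map_one (Ideal.Quotient.mkₐ R I)⟩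
  mul_mem := by
    rintro i j _ _ ⟨a, ha, rfl⟩ ⟨b, hb, rfl⟩
    exact ⟨a * b, SetLike.GradedMul.mul_mem ha hb, map_mul (Ideal.Quotient.mkₐ R I) a b⟩

theorem quotientGrading_isInternal {ι : Type*} [DecidableEq ι] [AddMonoid ι]
    (𝒜 : ι → Submodule R A) [GradedAlgebra 𝒜] (I : Ideal A) (hI : I.IsHomogeneous 𝒜) :
    DirectSum.IsInternal (quotientGrading 𝒜 I) := by
  let p : ι → (A ⧸ I) →+ (A ⧸ I) := fun i =>
    QuotientAddGroup.map I.toAddSubgroup I.toAddSubgroup (GradedRing.proj 𝒜 i)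
      (fun a ha => hI i ha)
  have hp : ∀ i (a : A), p i (Ideal.Quotient.mk I a) =
      Ideal.Quotient.mk I (GradedRing.proj 𝒜 i a) := fun i a => rfl
  refine isInternal_of_separated _ p ?_ ?_ ?_
  · rintro i _ ⟨a, ha, rfl⟩ h
    have h' : p i (Ideal.Quotient.mk I a) = 0 := h
    rw [hp, GradedRing.proj_apply, DirectSum.decompose_of_mem_same 𝒜 ha] at h'
    exact h'
  · rintro i j hij _ ⟨a, ha, rfl⟩
    change p i (Ideal.Quotient.mk I a) = 0
    rw [hp, GradedRing.proj_apply, DirectSum.decompose_of_mem_ne 𝒜 ha hij, map_zero]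
  · have h := (DirectSum.Decomposition.isInternal 𝒜).submodule_iSup_eq_top
    unfold quotientGrading
    rw [← Submodule.map_iSup, h, Submodule.map_top, LinearMap.range_eq_top]
    exact Ideal.Quotient.mkₐ_surjective R I

/-- The quotient of a graded algebra by a homogeneous ideal is a graded algebra. -/
@[reducible]
def quotientGradedAlgebra {ι : Type*} [DecidableEq ι] [AddMonoid ι]
    (𝒜 : ι → Submodule R A) [GradedAlgebra 𝒜] (I : Ideal A) (hI : I.IsHomogeneous 𝒜) :
    GradedAlgebra (quotientGrading 𝒜 I) :=
  (quotientGrading_isInternal 𝒜 I hI).gradedAlgebra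

/-- The diagonal subalgebra `⨁ₙ 𝒜 (n, n)` of a bigraded algebra. -/
def diagonal (𝒜 : ℕ × ℕ → Submodule R A) [SetLike.GradedMonoid 𝒜] : Subalgebra R A :=
  (⨆ n : ℕ, 𝒜 (n, n)).toSubalgebra
    (Submodule.mem_iSup_of_mem 0 (SetLike.GradedOne.one_mem (A := 𝒜)))
    (fun x y hx hy => by
      refine Submodule.iSup_induction _ (motive := fun x => x * y ∈ _) hx (fun n a ha => ?_)
        (by simp) (fun a b ha hb => by rw [add_mul]; exact add_mem ha hb)
      refine Submodule.iSup_induction _ (motive := fun y => a * y ∈ _) hy (fun m b hb => ?_)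
        (by simp) (fun b c hb hc => by rw [mul_add]; exact add_mem hb hc)
      exact Submodule.mem_iSup_of_mem (n + m) (SetLike.GradedMul.mul_mem ha hb))

/-- The piece of degree `n` of the diagonal subalgebra is `𝒜 (n, n)`. -/
def diagonalGrading (𝒜 : ℕ × ℕ → Submodule R A) [SetLike.GradedMonoid 𝒜] (n : ℕ) :
    Submodule R (diagonal 𝒜) :=
  (𝒜 (n, n)).comap (diagonal 𝒜).val.toLinearMap

instance diagonalGrading_gradedMonoid (𝒜 : ℕ × ℕ → Submodule R A) [SetLike.GradedMonoid 𝒜] :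
    SetLike.GradedMonoid (diagonalGrading 𝒜) where
  one_mem := SetLike.GradedOne.one_mem (A := 𝒜)
  mul_mem := fun _ _ _ _ ha hb => SetLike.GradedMul.mul_mem (A := 𝒜) ha hb

theorem diagonalGrading_isInternal (𝒜 : ℕ × ℕ → Submodule R A) [GradedAlgebra 𝒜] :
    DirectSum.IsInternal (diagonalGrading 𝒜) := by
  refine isInternal_of_separated _
    (fun n => (GradedRing.proj 𝒜 (n, n)).comp (diagonal 𝒜).val.toRingHom.toAddMonoidHom) ?_ ?_ ?_
  · intro n x hx h
    have h' : GradedRing.proj 𝒜 (n, n) (x : A) = 0 := h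
    have hx' : (x : A) ∈ 𝒜 (n, n) := hx
    rw [GradedRing.proj_apply, DirectSum.decompose_of_mem_same 𝒜 hx'] at h'
    exact Subtype.ext h'
  · intro n m hmn x hx
    change GradedRing.proj 𝒜 (n, n) (x : A) = 0
    have hx' : (x : A) ∈ 𝒜 (m, m) := hx
    rw [GradedRing.proj_apply, DirectSum.decompose_of_mem_ne 𝒜 hx' (by simpa using hmn)]
  · rw [eq_top_iff]
    rintro ⟨x, hx⟩ -
    have key : ∀ n, ∀ a ∈ 𝒜 (n, n), a ∈ (⨆ i, diagonalGrading 𝒜 i).map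
        (diagonal 𝒜).val.toLinearMap := fun n a ha =>
      ⟨⟨a, Submodule.mem_iSup_of_mem n ha⟩,
        Submodule.mem_iSup_of_mem (p := diagonalGrading 𝒜) n ha, rfl⟩
    obtain ⟨y, hy, hyx⟩ := (iSup_le key : (⨆ n : ℕ, 𝒜 (n, n)) ≤ _) hx
    have : y = ⟨x, hx⟩ := Subtype.ext hyx
    exact this ▸ hy

/-- The diagonal subalgebra of a bigraded algebra is a graded algebra. -/
@[reducible]
def diagonalGradedAlgebra (𝒜 : ℕ × ℕ → Submodule R A) [GradedAlgebra 𝒜] :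
    GradedAlgebra (diagonalGrading 𝒜) :=
  (diagonalGrading_isInternal 𝒜).gradedAlgebra

end Graded

/-! ### Double covers of `ℙ¹ × ℙ²` -/

/-- Quadratic forms in `ℝ[u, v, w]`, i.e. homogeneous polynomials of degree two. -/
abbrev TernaryQuadraticForm : Type := homogeneousSubmodule (Fin 3) ℝ 2

/-- The variables `t₀, t₁` (`Sum.inl`) and `u, v, w` (`Sum.inr`) on `ℙ¹ × ℙ²`. -/
abbrev BaseVar : Type := Fin 2 ⊕ Fin 3

/-- The variables of the double cover: those of `ℙ¹ × ℙ²` (`some`) and `z` (`none`). -/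
abbrev Var : Type := Option BaseVar

/-- The bidegrees of the variables: `t₀, t₁` have bidegree `(1, 0)`, while `u, v, w` have
bidegree `(0, 1)`. -/
def baseBidegree : BaseVar → ℕ × ℕ :=
  Sum.elim (fun _ => (1, 0)) (fun _ => (0, 1))

/-- The bidegrees of all the variables: `z` is a section of `𝒪(1, 1)`. -/
def bidegree : Var → ℕ × ℕ
  | none => (1, 1)
  | some i => baseBidegree i

/-- Bihomogeneous polynomials of bidegree `(2, 2)` in `ℝ[t₀, t₁; u, v, w]`. -/
abbrev BranchForm : Type := weightedHomogeneousSubmodule ℝ baseBidegree (2, 2)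

instance bigradedAlgebra : GradedAlgebra (weightedHomogeneousSubmodule ℝ bidegree) :=
  weightedGradedAlgebra ℝ bidegree

/-- The ideal `(z² - F)` of `ℝ[t₀, t₁, u, v, w, z]`. -/
def coverIdeal (F : BranchForm) : Ideal (MvPolynomial Var ℝ) :=
  Ideal.span {X none ^ 2 - rename some (F : MvPolynomial BaseVar ℝ)}

/-- Renaming variables compatibly with their weights preserves weighted homogeneity. -/
theorem isWeightedHomogeneous_rename {σ τ M : Type*} [AddCommMonoid M] {w : τ → M} {f : σ → τ}
    {p : MvPolynomial σ ℝ} {m : M} (hp : IsWeightedHomogeneous (w ∘ f) p m) :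
    IsWeightedHomogeneous w (rename f p) m := by
  intro d hd
  obtain ⟨e, rfl, he⟩ := coeff_rename_ne_zero f p d hd
  rw [← hp he, Finsupp.weight_apply, Finsupp.weight_apply,
    Finsupp.sum_mapDomain_index (by simp) (by simp [add_smul])]
  rfl

theorem coverIdeal_isHomogeneous (F : BranchForm) :
    (coverIdeal F).IsHomogeneous (weightedHomogeneousSubmodule ℝ bidegree) := by
  refine Ideal.homogeneous_span _ _ ?_
  rintro _ rfl
  refine ⟨(2, 2), ?_⟩
  have h1 : IsWeightedHomogeneous bidegree (X none ^ 2 : MvPolynomial Var ℝ) (2, 2) :=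
    (isWeightedHomogeneous_X ℝ bidegree none).pow 2
  exact h1.sub (isWeightedHomogeneous_rename (w := bidegree) (f := some) F.2)

/-- The bigraded pieces of `ℝ[t₀, t₁, u, v, w, z] / (z² - F)`. -/
abbrev coverBigrading (F : BranchForm) :
    ℕ × ℕ → Submodule ℝ (MvPolynomial Var ℝ ⧸ coverIdeal F) :=
  quotientGrading (weightedHomogeneousSubmodule ℝ bidegree) (coverIdeal F)

instance coverBigradedAlgebra (F : BranchForm) : GradedAlgebra (coverBigrading F) :=
  quotientGradedAlgebra _ _ (coverIdeal_isHomogeneous F)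

/-- The graded pieces of the homogeneous coordinate ring
`⨁ₙ (ℝ[t₀, t₁, u, v, w, z] / (z² - F))₍ₙ,ₙ₎` of the double cover. -/
abbrev coverGrading (F : BranchForm) : ℕ → Submodule ℝ (diagonal (coverBigrading F)) :=
  diagonalGrading (coverBigrading F)

instance coverGradedAlgebra (F : BranchForm) : GradedAlgebra (coverGrading F) :=
  diagonalGradedAlgebra _

/-- The double cover `z² = F` of `ℙ¹ × ℙ²`, for `F` of bidegree `(2, 2)` and `z` a coordinate of
bidegree `(1, 1)`. It is the (multigraded) `Proj` of `ℝ[t₀, t₁, u, v, w, z] / (z² - F)`, which is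
the usual `Proj` of the diagonal subring since `𝒪(1, 1)` is ample: it is covered by the six affine
charts `tᵢ ≠ 0`, `xⱼ ≠ 0` (`x = (u, v, w)`), the basic opens of `tᵢ xⱼ`, on which it is
`z² = F` with `tᵢ = xⱼ = 1`. -/
def doubleCover (F : BranchForm) : Scheme.{0} :=
  Proj (coverGrading F)

/-- The structure morphism of the double cover over `Spec ℝ`. -/
def doubleCover.structureMap (F : BranchForm) : doubleCover F ⟶ Spec (CommRingCat.of ℝ) :=
  Proj.toSpecZero (coverGrading F) ≫
    Spec.map (CommRingCat.ofHom (algebraMap ℝ (coverGrading F 0)))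

/-! ### The quartic, its double cover and the quadratic twist -/

theorem isWeightedHomogeneous_rename_inr (Q : TernaryQuadraticForm) :
    IsWeightedHomogeneous baseBidegree
      (rename Sum.inr (Q : MvPolynomial (Fin 3) ℝ) : MvPolynomial BaseVar ℝ) (0, 2) := by
  refine isWeightedHomogeneous_rename fun d hd => ?_
  have h : Finsupp.weight 1 d = 2 := Q.2 hd
  rw [Finsupp.weight_apply] at h ⊢
  have h1 : (d.sum fun i c => c • (baseBidegree ∘ Sum.inr) i) =
      (d.sum fun i c => c • (1 : Fin 3 → ℕ) i) • ((0, 1) : ℕ × ℕ) := by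
    simp only [Finsupp.sum, Finset.sum_smul]
    exact Finset.sum_congr rfl fun i _ => by simp [baseBidegree]
  rw [h1, h]
  rfl

theorem isWeightedHomogeneous_t_mul_t (i j : Fin 2) :
    IsWeightedHomogeneous baseBidegree
      (X (Sum.inl i) * X (Sum.inl j) : MvPolynomial BaseVar ℝ) (2, 0) :=
  (isWeightedHomogeneous_X ℝ baseBidegree (Sum.inl i)).mul
    (isWeightedHomogeneous_X ℝ baseBidegree (Sum.inl j))

/-- The form `t₀² Q₁ + 2 t₀ t₁ Q₂ + t₁² Q₃`. -/
def branchForm (Q₁ Q₂ Q₃ : TernaryQuadraticForm) : BranchForm :=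
  ⟨X (Sum.inl 0) ^ 2 * rename Sum.inr Q₁.1
      + 2 * X (Sum.inl 0) * X (Sum.inl 1) * rename Sum.inr Q₂.1
      + X (Sum.inl 1) ^ 2 * rename Sum.inr Q₃.1, by
    have h (i j) (Q : TernaryQuadraticForm) :=
      (isWeightedHomogeneous_t_mul_t i j).mul (isWeightedHomogeneous_rename_inr Q)
    refine (congrArg (· ∈ weightedHomogeneousSubmodule ℝ baseBidegree (2, 2)) ?_).mp
      (((h 0 0 Q₁).add ((h 0 1 Q₂).add (h 0 1 Q₂))).add (h 1 1 Q₃))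
    ring⟩

/-- The form `-t₀² Q₁ + 2 t₀ t₁ Q₂ - t₁² Q₃`. -/
def twistedBranchForm (Q₁ Q₂ Q₃ : TernaryQuadraticForm) : BranchForm :=
  ⟨-X (Sum.inl 0) ^ 2 * rename Sum.inr Q₁.1
      + 2 * X (Sum.inl 0) * X (Sum.inl 1) * rename Sum.inr Q₂.1
      - X (Sum.inl 1) ^ 2 * rename Sum.inr Q₃.1, by
    have h (i j) (Q : TernaryQuadraticForm) :=
      (isWeightedHomogeneous_t_mul_t i j).mul (isWeightedHomogeneous_rename_inr Q)
    refine (congrArg (· ∈ weightedHomogeneousSubmodule ℝ baseBidegree (2, 2)) ?_).mp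
      (((h 0 0 Q₁).neg.add ((h 0 1 Q₂).add (h 0 1 Q₂))).sub (h 1 1 Q₃))
    ring⟩

/-- The quartic form `Q₁ Q₃ - Q₂²` defining the plane curve `Δ`. -/
def quartic (Q₁ Q₂ Q₃ : TernaryQuadraticForm) : MvPolynomial (Fin 3) ℝ :=
  Q₁.1 * Q₃.1 - Q₂.1 ^ 2

/-- The plane curve `f = 0` over `ℝ` (`f` homogeneous) is smooth: it has no complex point at which
all the partial derivatives of `f` vanish. -/
def IsSmoothPlaneCurve (f : MvPolynomial (Fin 3) ℝ) : Prop :=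
  ∀ a : Fin 3 → ℂ, a ≠ 0 → aeval a f = 0 → ∃ i, aeval a (pderiv i f) ≠ 0

/-- The real points of the plane curve `f = 0`, for `f` homogeneous. -/
def realPoints (f : MvPolynomial (Fin 3) ℝ) : Set (Projectivization ℝ (Fin 3 → ℝ)) :=
  {p | eval p.rep f = 0}

/-- A threefold over `ℝ` is rational (over `ℝ`) if it is birational over `ℝ` to `𝔸³`. -/
def IsRationalThreefold {W : Scheme.{0}} (sW : W ⟶ Spec (CommRingCat.of ℝ)) : Prop :=
  Scheme.BirationalOver sW
    (𝔸(Fin 3; Spec (CommRingCat.of ℝ)) ↘ Spec (CommRingCat.of ℝ))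

end DoubleCover

end

noncomputable section

namespace DoubleCover

/-! ### Evaluation of quadratic forms -/

section Evaluation

variable {S S' : Type*} [CommRing S] [Algebra ℝ S] [CommRing S'] [Algebra ℝ S']

/-! At a real point `p` of the quartic, `Q₁ Q₃ = Q₂²`, so the values of `Q₁` and `Q₃` do not have
opposite signs. Hence either `(Q₁, Q₂, Q₃)` or `(-Q₁, Q₂, -Q₃)` takes at `p` the form `(r², rs, s²)`
(`exists_sq_or_neg_sq`). The second triple defines the twisted cover and the same quartic, so it
suffices to treat the first. There `F(t, p) = (r t₀ + s t₁)²`, and `z = r t₀ + s t₁` over `p` is a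
section of the quadric surface bundle `Y → ℙ¹`. A quadric with a rational point is rational by
projection from the point; doing this over the function field of `ℙ¹` makes `Y` rational.

The projection is written out. Normalize `pⱼ = 1` and set `λ = r t₀ + s t₁`. A line through the
section is `x = p + μ m`, `z = λ + μ` with `mⱼ = 0` and `t = (1, T)`. Besides `μ = 0` it meets `Y`
where `μ U = V`, with `U = 1 - F(m)` and `V = F(p, m) - 2λ`. Conversely `T = t₁/t₀` and `m = t₀ y /
G`, where `y = x - xⱼ p` and `G = z - λ xⱼ`. The index `j`, left free by `mⱼ = 0`, carries the
variable `T`.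

These maps identify the open set `U V ≠ 0` of `𝔸³` with the basic open set `t₀ xⱼ G H ≠ 0` of `Y`
(`chartEquiv`), where `G² - F(y) = xⱼ H`. Both open sets are dense, which gives birationality.

Smoothness enters twice. It excludes a common zero of the three forms, so `(r, s) ≠ 0` and `V ≠ 0`;
and it prevents `F` from being a square, so the coordinate ring of `Y` is a domain. -/

theorem exists_eq_sum_coeff (Q : TernaryQuadraticForm) :
    ∃ a : Fin 3 → Fin 3 → ℝ, Q.1 = ∑ i, ∑ k, C (a i k) * X i * X k := by
  obtain ⟨Q, hQ⟩ := Q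
  -- Degree two is the square of degree one, so it is enough to treat products of two linear forms
  -- and sums. The coefficient matrix need not be symmetric.
  rw [← homogeneousSubmodule_one_pow, pow_two, homogeneousSubmodule_one_eq_span_X] at hQ
  change ∃ a : Fin 3 → Fin 3 → ℝ, Q = ∑ i, ∑ k, C (a i k) * X i * X k
  refine Submodule.mul_induction_on hQ ?_ ?_
  · intro x hx y hy
    obtain ⟨c, rfl⟩ := (Submodule.mem_span_range_iff_exists_fun ℝ).1 hx
    obtain ⟨d, rfl⟩ := (Submodule.mem_span_range_iff_exists_fun ℝ).1 hy
    refine ⟨fun i k => c i * d k, ?_⟩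
    rw [Finset.sum_mul_sum]
    refine Finset.sum_congr rfl fun i _ => Finset.sum_congr rfl fun k _ => ?_
    rw [smul_eq_C_mul, smul_eq_C_mul, C_mul]
    ring
  · rintro x y ⟨a, ha⟩ ⟨b, hb⟩
    refine ⟨fun i k => a i k + b i k, ?_⟩
    rw [ha, hb, ← Finset.sum_add_distrib]
    refine Finset.sum_congr rfl fun i _ => ?_
    rw [← Finset.sum_add_distrib]
    refine Finset.sum_congr rfl fun k _ => ?_
    rw [C_add]
    ring

/-- The polarization `Q(v + w) - Q(v) - Q(w)` of a quadratic form. -/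
def polar (Q : TernaryQuadraticForm) (v w : Fin 3 → S) : S :=
  aeval (v + w) Q.1 - aeval v Q.1 - aeval w Q.1

theorem aeval_smul (Q : TernaryQuadraticForm) (c : S) (v : Fin 3 → S) :
    aeval (c • v) Q.1 = c ^ 2 * aeval v Q.1 := by
  obtain ⟨a, ha⟩ := exists_eq_sum_coeff Q
  simp only [ha, Fin.sum_univ_three, map_add, map_mul, aeval_C, aeval_X, Pi.smul_apply,
    smul_eq_mul]
  ring

theorem polar_smul (Q : TernaryQuadraticForm) (c : S) (v w : Fin 3 → S) :
    polar Q v (c • w) = c * polar Q v w := by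
  obtain ⟨a, ha⟩ := exists_eq_sum_coeff Q
  simp only [polar, ha, Fin.sum_univ_three, map_add, map_mul, aeval_C, aeval_X, Pi.smul_apply,
    smul_eq_mul, Pi.add_apply]
  ring

theorem polar_eq_sum {Q : TernaryQuadraticForm} {a : Fin 3 → Fin 3 → ℝ}
    (ha : Q.1 = ∑ i, ∑ k, C (a i k) * X i * X k) (v w : Fin 3 → S) :
    polar Q v w = ∑ i, ∑ k, algebraMap ℝ S (a i k) * (v i * w k + w i * v k) := by
  simp only [polar, ha, Fin.sum_univ_three, map_add, map_mul, aeval_C, aeval_X, Pi.add_apply]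
  ring

/-- The value of `t₀² Q₁ + 2 t₀ t₁ Q₂ + t₁² Q₃` at a point with coordinates in an algebra. -/
def formValue (Q₁ Q₂ Q₃ : TernaryQuadraticForm) (t : Fin 2 → S) (v : Fin 3 → S) : S :=
  t 0 ^ 2 * aeval v Q₁.1 + 2 * t 0 * t 1 * aeval v Q₂.1 + t 1 ^ 2 * aeval v Q₃.1

/-- The polarization of `formValue` with respect to the second argument. -/
def formPolar (Q₁ Q₂ Q₃ : TernaryQuadraticForm) (t : Fin 2 → S) (v w : Fin 3 → S) : S :=
  t 0 ^ 2 * polar Q₁ v w + 2 * t 0 * t 1 * polar Q₂ v w + t 1 ^ 2 * polar Q₃ v w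

variable (Q₁ Q₂ Q₃ : TernaryQuadraticForm)

theorem aeval_branchForm (x : BaseVar → S) :
    aeval x (branchForm Q₁ Q₂ Q₃).1 =
      formValue Q₁ Q₂ Q₃ (fun i => x (Sum.inl i)) (fun i => x (Sum.inr i)) := by
  simp [branchForm, formValue, aeval_rename, Function.comp_def]

theorem formValue_add (t : Fin 2 → S) (v w : Fin 3 → S) :
    formValue Q₁ Q₂ Q₃ t (v + w) =
      formValue Q₁ Q₂ Q₃ t v + formPolar Q₁ Q₂ Q₃ t v w + formValue Q₁ Q₂ Q₃ t w := by
  simp only [formValue, formPolar, polar]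
  ring

theorem formValue_smul (c : S) (t : Fin 2 → S) (v : Fin 3 → S) :
    formValue Q₁ Q₂ Q₃ t (c • v) = c ^ 2 * formValue Q₁ Q₂ Q₃ t v := by
  simp only [formValue, aeval_smul]
  ring

theorem formValue_smul_left (c : S) (t : Fin 2 → S) (v : Fin 3 → S) :
    formValue Q₁ Q₂ Q₃ (c • t) v = c ^ 2 * formValue Q₁ Q₂ Q₃ t v := by
  simp only [formValue, Pi.smul_apply, smul_eq_mul]
  ring

theorem formPolar_smul (c : S) (t : Fin 2 → S) (v w : Fin 3 → S) :
    formPolar Q₁ Q₂ Q₃ t v (c • w) = c * formPolar Q₁ Q₂ Q₃ t v w := by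
  simp only [formPolar, polar_smul]
  ring

theorem formPolar_smul_left (c : S) (t : Fin 2 → S) (v w : Fin 3 → S) :
    formPolar Q₁ Q₂ Q₃ (c • t) v w = c ^ 2 * formPolar Q₁ Q₂ Q₃ t v w := by
  simp only [formPolar, Pi.smul_apply, smul_eq_mul]
  ring

theorem formPolar_smul_middle (c : S) (t : Fin 2 → S) (v w : Fin 3 → S) :
    formPolar Q₁ Q₂ Q₃ t (c • v) w = c * formPolar Q₁ Q₂ Q₃ t v w := by
  have h (Q : TernaryQuadraticForm) (v w : Fin 3 → S) : polar Q v w = polar Q w v := by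
    rw [polar, polar, add_comm v w]
    ring
  have h' (v w : Fin 3 → S) : formPolar Q₁ Q₂ Q₃ t v w = formPolar Q₁ Q₂ Q₃ t w v := by
    rw [formPolar, formPolar, h Q₁, h Q₂, h Q₃]
  rw [h', formPolar_smul, h']

theorem map_aeval_form (φ : S →ₐ[ℝ] S') (Q : TernaryQuadraticForm) (v : Fin 3 → S) :
    φ (aeval v Q.1) = aeval (fun i => φ (v i)) Q.1 :=
  comp_aeval_apply _ _ _

theorem map_formValue (φ : S →ₐ[ℝ] S') (t : Fin 2 → S) (v : Fin 3 → S) :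
    φ (formValue Q₁ Q₂ Q₃ t v) =
      formValue Q₁ Q₂ Q₃ (fun i => φ (t i)) (fun i => φ (v i)) := by
  simp only [formValue, map_add, map_mul, map_pow, map_ofNat, map_aeval_form]

theorem map_formPolar (φ : S →ₐ[ℝ] S') (t : Fin 2 → S) (v w : Fin 3 → S) :
    φ (formPolar Q₁ Q₂ Q₃ t v w) =
      formPolar Q₁ Q₂ Q₃ (fun i => φ (t i)) (fun i => φ (v i)) (fun i => φ (w i)) := by
  simp only [formPolar, polar, map_add, map_mul, map_pow, map_ofNat, map_sub, map_aeval_form,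
    Pi.add_def]

/-- The linear form `c₀ t₀ + c₁ t₁`. -/
def linearForm (c : Fin 2 → ℝ) (t : Fin 2 → S) : S :=
  algebraMap ℝ S (c 0) * t 0 + algebraMap ℝ S (c 1) * t 1

theorem linearForm_smul (c : Fin 2 → ℝ) (a : S) (t : Fin 2 → S) :
    linearForm c (a • t) = a * linearForm c t := by
  simp only [linearForm, Pi.smul_apply, smul_eq_mul]
  ring

theorem map_linearForm (φ : S →ₐ[ℝ] S') (c : Fin 2 → ℝ) (t : Fin 2 → S) :
    φ (linearForm c t) = linearForm c (fun i => φ (t i)) := by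
  simp [linearForm]

/-- A real vector, seen as a vector with coordinates in an algebra. -/
def realVector (p : Fin 3 → ℝ) : Fin 3 → S := fun i => algebraMap ℝ S (p i)

theorem map_realVector (φ : S →ₐ[ℝ] S') (p : Fin 3 → ℝ) :
    (fun i => φ (realVector p i)) = realVector p := by
  funext i
  simp [realVector]

/-- A real point `p` of the plane with a lift to the double cover `r² = Q₁, rs = Q₂, s² = Q₃` of
the discriminant curve, normalized by `pⱼ = 1`. -/
structure LiftedPoint where
  /-- the point of the plane -/
  p : Fin 3 → ℝ
  /-- the index of the coordinate normalized to `1` -/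
  j : Fin 3
  /-- the coordinates `(r, s)` of the lift -/
  c : Fin 2 → ℝ
  p_j : p j = 1
  c_ne : c ≠ 0
  eval₁ : eval p Q₁.1 = c 0 ^ 2
  eval₂ : eval p Q₂.1 = c 0 * c 1
  eval₃ : eval p Q₃.1 = c 1 ^ 2

variable {Q₁ Q₂ Q₃}

/-- This makes `z = r t₀ + s t₁` a section of `Y → ℙ¹` over `p`. -/
theorem LiftedPoint.formValue_eq (D : LiftedPoint Q₁ Q₂ Q₃) (t : Fin 2 → S) :
    formValue Q₁ Q₂ Q₃ t (realVector D.p) = linearForm D.c t ^ 2 := by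
  have h (Q : TernaryQuadraticForm) :
      aeval (realVector D.p : Fin 3 → S) Q.1 = algebraMap ℝ S (eval D.p Q.1) := by
    rw [← coe_aeval_eq_eval]
    exact aeval_algebraMap_apply _ _ _
  simp only [formValue, h, D.eval₁, D.eval₂, D.eval₃, linearForm, map_mul, map_pow]
  ring

end Evaluation

/-! ### The homogeneous coordinate ring of the double cover -/

section CoverRing

variable (Q₁ Q₂ Q₃ : TernaryQuadraticForm)

theorem algebraMap_mul_mem {S : Type*} [CommRing S] [Algebra ℝ S] {N : Submodule ℝ S} (c : ℝ)
    {a : S} (ha : a ∈ N) : algebraMap ℝ S c * a ∈ N :=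
  Algebra.smul_def c a ▸ N.smul_mem c ha

/-- The bigraded ring `ℝ[t₀, t₁, u, v, w, z] / (z² - F)`. -/
abbrev CoverRing (F : BranchForm) : Type := MvPolynomial Var ℝ ⧸ coverIdeal F

/-- The class of a variable in the bigraded coordinate ring. -/
def coord (F : BranchForm) (i : Var) : CoverRing F := Ideal.Quotient.mkₐ ℝ (coverIdeal F) (X i)

theorem coord_mem (F : BranchForm) (i : Var) : coord F i ∈ coverBigrading F (bidegree i) :=
  ⟨X i, isWeightedHomogeneous_X ℝ bidegree i, rfl⟩

theorem mkₐ_eq_aeval (F : BranchForm) :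
    Ideal.Quotient.mkₐ ℝ (coverIdeal F) = aeval (coord F) := by
  ext i
  simp [coord]

/-- The coordinates `t₀, t₁`. -/
def coordT (F : BranchForm) (i : Fin 2) : CoverRing F := coord F (some (Sum.inl i))

/-- The coordinates `u, v, w`. -/
def coordX (F : BranchForm) (i : Fin 3) : CoverRing F := coord F (some (Sum.inr i))

/-- The coordinate `z`. -/
def coordZ (F : BranchForm) : CoverRing F := coord F none

theorem coordT_mem (F : BranchForm) (i : Fin 2) : coordT F i ∈ coverBigrading F (1, 0) :=
  coord_mem F (some (Sum.inl i))

theorem coordX_mem (F : BranchForm) (i : Fin 3) : coordX F i ∈ coverBigrading F (0, 1) :=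
  coord_mem F (some (Sum.inr i))

theorem coordZ_mem (F : BranchForm) : coordZ F ∈ coverBigrading F (1, 1) :=
  coord_mem F none

theorem coordZ_sq :
    coordZ (branchForm Q₁ Q₂ Q₃) ^ 2 =
      formValue Q₁ Q₂ Q₃ (coordT (branchForm Q₁ Q₂ Q₃)) (coordX (branchForm Q₁ Q₂ Q₃)) := by
  have h : Ideal.Quotient.mkₐ ℝ (coverIdeal (branchForm Q₁ Q₂ Q₃))
      (X none ^ 2 - rename some (branchForm Q₁ Q₂ Q₃).1) = 0 :=
    Ideal.Quotient.eq_zero_iff_mem.2 (Ideal.subset_span rfl)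
  rw [map_sub, sub_eq_zero, mkₐ_eq_aeval, aeval_rename, aeval_branchForm, map_pow, aeval_X] at h
  exact h

/-- Substitution of a solution of `z² = F` into elements of the coordinate ring. -/
def coverLift {S : Type*} [CommRing S] [Algebra ℝ S] (t : Fin 2 → S) (x : Fin 3 → S) (z : S)
    (h : z ^ 2 = formValue Q₁ Q₂ Q₃ t x) : CoverRing (branchForm Q₁ Q₂ Q₃) →ₐ[ℝ] S :=
  Ideal.Quotient.liftₐ _ (aeval fun i : Var => i.elim z (Sum.elim t x)) (by
    intro a ha
    rw [← RingHom.mem_ker]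
    revert a
    change coverIdeal _ ≤ _
    rw [coverIdeal, Ideal.span_le, Set.singleton_subset_iff, SetLike.mem_coe, RingHom.mem_ker,
      map_sub, aeval_rename, aeval_branchForm, map_pow, aeval_X, sub_eq_zero]
    exact h)

section coverLift

variable {Q₁ Q₂ Q₃} {S : Type*} [CommRing S] [Algebra ℝ S] {t : Fin 2 → S} {x : Fin 3 → S} {z : S}
  (h : z ^ 2 = formValue Q₁ Q₂ Q₃ t x)

theorem coverLift_coord (i : Var) :
    coverLift Q₁ Q₂ Q₃ t x z h (coord _ i) = i.elim z (Sum.elim t x) := by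
  change aeval _ (X i) = _
  simp

theorem coverLift_coordT (i : Fin 2) : coverLift Q₁ Q₂ Q₃ t x z h (coordT _ i) = t i :=
  coverLift_coord h _

theorem coverLift_coordX (i : Fin 3) : coverLift Q₁ Q₂ Q₃ t x z h (coordX _ i) = x i :=
  coverLift_coord h _

theorem coverLift_coordZ : coverLift Q₁ Q₂ Q₃ t x z h (coordZ _) = z :=
  coverLift_coord h _

end coverLift

/-- Each monomial of weight `m` picks up the same factor `α ^ m.1 * β ^ m.2`: this is the action of
the two-dimensional torus defining the bigrading. -/
theorem aeval_scale {S : Type*} [CommRing S] [Algebra ℝ S] (α β : S) (v : Var → S)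
    {P : MvPolynomial Var ℝ} {m : ℕ × ℕ} (hP : IsWeightedHomogeneous bidegree P m) :
    aeval (fun i => α ^ (bidegree i).1 * β ^ (bidegree i).2 * v i) P =
      α ^ m.1 * β ^ m.2 * aeval v P := by
  rw [aeval_def, aeval_def, eval₂_eq', eval₂_eq', Finset.mul_sum]
  refine Finset.sum_congr rfl fun d hd => ?_
  have hw := hP (mem_support_iff.1 hd)
  rw [Finsupp.weight_apply, Finsupp.sum_fintype _ _ (by simp)] at hw
  have h1 : m.1 = ∑ i, (bidegree i).1 * d i := by
    rw [← hw, Prod.fst_sum]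
    exact Finset.sum_congr rfl fun i _ => by simp [mul_comm]
  have h2 : m.2 = ∑ i, (bidegree i).2 * d i := by
    rw [← hw, Prod.snd_sum]
    exact Finset.sum_congr rfl fun i _ => by simp [mul_comm]
  simp only [mul_pow, Finset.prod_mul_distrib, ← pow_mul, Finset.prod_pow_eq_pow_sum, ← h1, ← h2]
  ring

/-- An algebra map that rescales the coordinates rescales elements according to bidegree. -/
theorem map_eq_of_scale {F : BranchForm} {S : Type*} [CommRing S] [Algebra ℝ S] (α β : S)
    (φ ρ : CoverRing F →ₐ[ℝ] S)
    (h : ∀ i, ρ (coord F i) = α ^ (bidegree i).1 * β ^ (bidegree i).2 * φ (coord F i))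
    {m : ℕ × ℕ} {a : CoverRing F} (ha : a ∈ coverBigrading F m) :
    ρ a = α ^ m.1 * β ^ m.2 * φ a := by
  obtain ⟨P, hP, rfl⟩ := ha
  have key (χ : CoverRing F →ₐ[ℝ] S) : χ ((Ideal.Quotient.mkₐ ℝ (coverIdeal F)).toLinearMap P) =
      aeval (fun i => χ (coord F i)) P := by
    rw [AlgHom.toLinearMap_apply, mkₐ_eq_aeval]
    exact comp_aeval_apply _ _ _
  rw [key, key, ← aeval_scale α β _ hP]
  simp only [h]

end CoverRing

/-! ### The equation of the cover centred at the section -/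

namespace LiftedPoint

variable {Q₁ Q₂ Q₃ : TernaryQuadraticForm} (D : LiftedPoint Q₁ Q₂ Q₃)

/-- The coordinates `x - xⱼ p` vanishing at `p`. -/
def vecY : Fin 3 → CoverRing (branchForm Q₁ Q₂ Q₃) :=
  fun i => coordX _ i - coordX _ D.j * realVector D.p i

/-- The value of the linear form `r t₀ + s t₁`. -/
def lam : CoverRing (branchForm Q₁ Q₂ Q₃) := linearForm D.c (coordT _)

/-- The function `z - (r t₀ + s t₁) xⱼ` vanishing on the section over `p`. -/
def elemG : CoverRing (branchForm Q₁ Q₂ Q₃) := coordZ _ - D.lam * coordX _ D.j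

/-- The residual factor of the equation `G² - F(y) = xⱼ H`. -/
def elemH : CoverRing (branchForm Q₁ Q₂ Q₃) :=
  formPolar Q₁ Q₂ Q₃ (coordT _) (realVector D.p) D.vecY - 2 * D.lam * D.elemG

/-- Expand `z² = F(x)` at `x = xⱼ p + y` and `z = G + λ xⱼ`. The terms `λ² xⱼ²` cancel because the
section lies on the cover, and what remains besides `G² - F(y)` is divisible by `xⱼ`. -/
theorem elemG_sq_sub :
    D.elemG ^ 2 - formValue Q₁ Q₂ Q₃ (coordT _) D.vecY = coordX _ D.j * D.elemH := by
  have h := coordZ_sq Q₁ Q₂ Q₃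
  have hx : coordX (branchForm Q₁ Q₂ Q₃) =
      coordX (branchForm Q₁ Q₂ Q₃) D.j • realVector D.p + D.vecY := by
    funext i
    simp [vecY]
  rw [hx, formValue_add, formValue_smul, D.formValue_eq, formPolar_smul_middle] at h
  simp only [elemH, elemG, lam] at h ⊢
  linear_combination h

/-- The denominator `t₀ xⱼ² G H`, of bidegree `(4, 4)`. -/
def den : CoverRing (branchForm Q₁ Q₂ Q₃) :=
  coordT _ 0 * coordX _ D.j ^ 2 * D.elemG * D.elemH

theorem vecY_mem (i : Fin 3) : D.vecY i ∈ coverBigrading (branchForm Q₁ Q₂ Q₃) (0, 1) := by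
  refine Submodule.sub_mem _ (coordX_mem _ i) ?_
  rw [mul_comm]
  exact algebraMap_mul_mem _ (coordX_mem _ _)

theorem lam_mem : D.lam ∈ coverBigrading (branchForm Q₁ Q₂ Q₃) (1, 0) :=
  Submodule.add_mem _ (algebraMap_mul_mem _ (coordT_mem _ _))
    (algebraMap_mul_mem _ (coordT_mem _ _))

theorem elemG_mem : D.elemG ∈ coverBigrading (branchForm Q₁ Q₂ Q₃) (1, 1) :=
  Submodule.sub_mem _ (coordZ_mem _)
    (SetLike.GradedMul.mul_mem (i := (1, 0)) (j := (0, 1)) D.lam_mem (coordX_mem _ _))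

theorem polar_mem (Q : TernaryQuadraticForm) :
    polar Q (realVector D.p) D.vecY ∈ coverBigrading (branchForm Q₁ Q₂ Q₃) (0, 1) := by
  obtain ⟨a, ha⟩ := exists_eq_sum_coeff Q
  rw [polar_eq_sum ha]
  refine Submodule.sum_mem _ fun i _ => Submodule.sum_mem _ fun k _ => ?_
  rw [mul_comm (D.vecY i)]
  exact algebraMap_mul_mem _ (Submodule.add_mem _ (algebraMap_mul_mem _ (D.vecY_mem _))
    (algebraMap_mul_mem _ (D.vecY_mem _)))

theorem elemH_mem : D.elemH ∈ coverBigrading (branchForm Q₁ Q₂ Q₃) (2, 1) := by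
  have h (i k : Fin 2) (Q : TernaryQuadraticForm) :
      coordT _ i * coordT _ k * polar Q (realVector D.p) D.vecY ∈
        coverBigrading (branchForm Q₁ Q₂ Q₃) (2, 1) :=
    SetLike.GradedMul.mul_mem (i := (2, 0)) (j := (0, 1))
      (SetLike.GradedMul.mul_mem (i := (1, 0)) (j := (1, 0)) (coordT_mem _ i) (coordT_mem _ k))
      (D.polar_mem Q)
  have h' : D.lam * D.elemG ∈ coverBigrading (branchForm Q₁ Q₂ Q₃) (2, 1) :=
    SetLike.GradedMul.mul_mem (i := (1, 0)) (j := (1, 1)) D.lam_mem D.elemG_mem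
  refine (congrArg (· ∈ coverBigrading (branchForm Q₁ Q₂ Q₃) (2, 1)) ?_).mp
    (Submodule.sub_mem _ (Submodule.add_mem _ (Submodule.add_mem _ (h 0 0 Q₁)
      (Submodule.add_mem _ (h 0 1 Q₂) (h 0 1 Q₂))) (h 1 1 Q₃)) (Submodule.add_mem _ h' h'))
  simp only [elemH, formPolar]
  ring

/-- The square on `xⱼ` serves only to make the bidegree diagonal: `(1, 0) + (0, 2) + (1, 1) + (2, 1)
= (4, 4)`. -/
theorem den_mem : D.den ∈ coverBigrading (branchForm Q₁ Q₂ Q₃) (4, 4) :=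
  SetLike.GradedMul.mul_mem (i := (2, 3)) (j := (2, 1))
    (SetLike.GradedMul.mul_mem (i := (1, 2)) (j := (1, 1))
      (SetLike.GradedMul.mul_mem (i := (1, 0)) (j := (0, 2)) (coordT_mem _ _)
        (SetLike.pow_mem_graded (i := ((0, 1) : ℕ × ℕ)) 2 (coordX_mem _ _))) D.elemG_mem)
    D.elemH_mem

end LiftedPoint

namespace LiftedPoint

variable {Q₁ Q₂ Q₃ : TernaryQuadraticForm} (D : LiftedPoint Q₁ Q₂ Q₃)

/-! ### Projection from the section: the parametrizing side -/

/-- The parameters `(1, T)` of the base line, where `T` is the variable of index `j`. -/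
def polyT : Fin 2 → MvPolynomial (Fin 3) ℝ := ![1, X D.j]

/-- The direction vector, whose coordinate of index `j` vanishes. -/
def polyM : Fin 3 → MvPolynomial (Fin 3) ℝ := fun i => if i = D.j then 0 else X i

/-- The polynomial `1 - F(m)`. -/
def polyU : MvPolynomial (Fin 3) ℝ := 1 - formValue Q₁ Q₂ Q₃ D.polyT D.polyM

/-- The polynomial `F(p, m) - 2 (r + s T)`, with `F(p, m)` the polarization. -/
def polyV : MvPolynomial (Fin 3) ℝ :=
  formPolar Q₁ Q₂ Q₃ D.polyT (realVector D.p) D.polyM - 2 * linearForm D.c D.polyT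

/-- At `m = 0` the factor `U` is `1` and `V` is `-2 (r + s T)`, which is nonzero for some `T`
because `(r, s) ≠ 0`. -/
theorem polyU_mul_polyV_ne_zero : D.polyU * D.polyV ≠ 0 := by
  obtain ⟨T, hT⟩ : ∃ T : ℝ, D.c 0 + D.c 1 * T ≠ 0 := by
    by_contra! h
    have h0 := h 0
    have h1 := h 1
    refine D.c_ne (funext fun i => ?_)
    fin_cases i <;> simp <;> linarith
  intro h
  have h' := congrArg (aeval (Pi.single D.j T : Fin 3 → ℝ)) h
  -- The zero vector is written `0 • 0` so that the homogeneity lemmas make the terms in `m` vanish.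
  have hM : (fun i => aeval (Pi.single D.j T : Fin 3 → ℝ) (D.polyM i)) =
      (0 : ℝ) • (0 : Fin 3 → ℝ) := by
    funext i
    by_cases hi : i = D.j <;> simp [polyM, hi]
  rw [map_mul, polyU, polyV, map_sub, map_sub, map_formValue, map_formPolar, map_mul,
    map_linearForm, hM, formValue_smul, formPolar_smul] at h'
  simp [linearForm, polyT] at h'
  exact hT h'

/-- The coordinate ring of the open subset of `𝔸³` on which the parametrization is defined and
invertible. -/
abbrev LocRing : Type := Localization.Away (D.polyU * D.polyV)

instance : IsDomain D.LocRing :=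
  IsLocalization.isDomain_localization
    (powers_le_nonZeroDivisors_of_noZeroDivisors D.polyU_mul_polyV_ne_zero)

/-- The localization map as a map of `ℝ`-algebras. -/
def toLoc : MvPolynomial (Fin 3) ℝ →ₐ[ℝ] D.LocRing := IsScalarTower.toAlgHom ℝ _ _

theorem isUnit_toLoc : IsUnit (D.toLoc D.polyU * D.toLoc D.polyV) := by
  rw [← map_mul]
  exact IsLocalization.Away.algebraMap_isUnit (D.polyU * D.polyV)

theorem isUnit_polyU : IsUnit (D.toLoc D.polyU) := isUnit_of_mul_isUnit_left D.isUnit_toLoc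

theorem isUnit_polyV : IsUnit (D.toLoc D.polyV) := isUnit_of_mul_isUnit_right D.isUnit_toLoc

/-- The parameter `μ` of the second intersection point of a line through the section. -/
def mu : D.LocRing := D.toLoc D.polyV * D.isUnit_polyU.unit⁻¹.1

theorem mu_mul : D.mu * D.toLoc D.polyU = D.toLoc D.polyV := by
  rw [mu, mul_assoc, IsUnit.val_inv_mul, mul_one]

theorem isUnit_mu : IsUnit D.mu := D.isUnit_polyV.mul (Units.isUnit _)

/-- The coordinates `(1, T)` in the localization. -/
def locT : Fin 2 → D.LocRing := fun i => D.toLoc (D.polyT i)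

/-- The direction vector in the localization. -/
def locM : Fin 3 → D.LocRing := fun i => D.toLoc (D.polyM i)

theorem toLoc_polyU : D.toLoc D.polyU = 1 - formValue Q₁ Q₂ Q₃ D.locT D.locM := by
  change D.toLoc (1 - formValue Q₁ Q₂ Q₃ D.polyT D.polyM) = _
  rw [map_sub, map_one, map_formValue]
  rfl

theorem toLoc_polyV : D.toLoc D.polyV =
    formPolar Q₁ Q₂ Q₃ D.locT (realVector D.p) D.locM - 2 * linearForm D.c D.locT := by
  change D.toLoc (formPolar Q₁ Q₂ Q₃ D.polyT (realVector D.p) D.polyM -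
    2 * linearForm D.c D.polyT) = _
  rw [map_sub, map_formPolar, map_mul, map_linearForm, map_realVector, map_ofNat]
  rfl

/-- The difference of the two sides is `μ (μ U - V)`. The root `μ = 0` is the section itself, and `μ
= V / U` is the second intersection point. -/
theorem param_equation : (linearForm D.c D.locT + D.mu) ^ 2 =
    formValue Q₁ Q₂ Q₃ D.locT (realVector D.p + D.mu • D.locM) := by
  have h := D.mu_mul
  rw [toLoc_polyU, toLoc_polyV] at h
  rw [formValue_add, formValue_smul, formPolar_smul, D.formValue_eq]
  linear_combination D.mu * h

/-- The parametrization of the double cover by lines through the section over `p`. -/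
def param : CoverRing (branchForm Q₁ Q₂ Q₃) →ₐ[ℝ] D.LocRing :=
  coverLift Q₁ Q₂ Q₃ _ _ _ D.param_equation

theorem param_coordT (i : Fin 2) : D.param (coordT _ i) = D.locT i := coverLift_coordT _ i

theorem param_coordX (i : Fin 3) :
    D.param (coordX _ i) = algebraMap ℝ _ (D.p i) + D.mu * D.locM i := coverLift_coordX _ i

theorem param_coordZ : D.param (coordZ _) = linearForm D.c D.locT + D.mu := coverLift_coordZ _

theorem param_coordT_zero : D.param (coordT _ 0) = 1 := by
  simp [param_coordT, locT, polyT]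

theorem param_coordX_j : D.param (coordX _ D.j) = 1 := by
  simp [param_coordX, locM, polyM, D.p_j]

theorem param_lam : D.param D.lam = linearForm D.c D.locT := by
  rw [lam, map_linearForm]
  simp only [param_coordT]

theorem param_vecY (i : Fin 3) : D.param (D.vecY i) = D.mu * D.locM i := by
  rw [vecY, map_sub, map_mul, param_coordX_j, param_coordX, one_mul, realVector, AlgHom.commutes,
    add_sub_cancel_left]

theorem param_elemG : D.param D.elemG = D.mu := by
  simp [elemG, param_coordX_j, param_coordZ, param_lam]

theorem param_elemH : D.param D.elemH = D.mu * D.toLoc D.polyV := by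
  have h : (fun i => D.param (D.vecY i)) = D.mu • D.locM := funext D.param_vecY
  rw [elemH, map_sub, map_formPolar, map_realVector, h, formPolar_smul, toLoc_polyV]
  simp only [map_mul, map_ofNat, param_lam, param_elemG, param_coordT]
  ring

/-- Since `t₀` and `xⱼ` go to `1`, `G` to `μ` and `H` to `μ V`, the denominator goes to `μ² V`, a
unit once `U` and `V` are inverted. -/
theorem isUnit_param_den : IsUnit (D.param D.den) := by
  simp only [den, map_mul, map_pow, param_coordX_j, param_coordT_zero, param_elemG, param_elemH]
  simpa using D.isUnit_mu.mul (D.isUnit_mu.mul D.isUnit_polyV)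

theorem den_ne_zero : D.den ≠ 0 := fun h => by
  have := D.isUnit_param_den
  rw [h, map_zero] at this
  exact not_isUnit_zero this

end LiftedPoint

namespace LiftedPoint

open HomogeneousLocalization

variable {Q₁ Q₂ Q₃ : TernaryQuadraticForm} (D : LiftedPoint Q₁ Q₂ Q₃)

/-! ### The affine chart of the double cover -/

theorem mem_diagonal {n : ℕ} {a : CoverRing (branchForm Q₁ Q₂ Q₃)}
    (ha : a ∈ coverBigrading (branchForm Q₁ Q₂ Q₃) (n, n)) :
    a ∈ diagonal (coverBigrading (branchForm Q₁ Q₂ Q₃)) :=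
  Submodule.mem_iSup_of_mem n ha

/-- The denominator as an element of the diagonal subring. -/
def diagDen : diagonal (coverBigrading (branchForm Q₁ Q₂ Q₃)) :=
  ⟨D.den, mem_diagonal D.den_mem⟩

theorem diagDen_mem : D.diagDen ∈ coverGrading (branchForm Q₁ Q₂ Q₃) 4 := D.den_mem

/-- The coordinate ring of the basic open subset of the double cover defined by the denominator. -/
abbrev Chart : Type := Away (coverGrading (branchForm Q₁ Q₂ Q₃)) D.diagDen

/-- The fraction `a / denⁿ`, for `a` of bidegree `(4n, 4n)`. -/
def frac (n : ℕ) (a : CoverRing (branchForm Q₁ Q₂ Q₃))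
    (ha : a ∈ coverBigrading (branchForm Q₁ Q₂ Q₃) (n • 4, n • 4)) : D.Chart :=
  Away.mk _ D.diagDen_mem n ⟨a, mem_diagonal ha⟩ ha

theorem exists_eq_frac (w : D.Chart) : ∃ n a ha, w = D.frac n a ha := by
  obtain ⟨n, a, ha, rfl⟩ := Away.mk_surjective _ D.diagDen_mem w
  exact ⟨n, a, ha, rfl⟩

/-- The structure map of the chart. -/
def chartScalar : ℝ →+* D.Chart :=
  (fromZeroRingHom (coverGrading (branchForm Q₁ Q₂ Q₃)) _).comp
    (algebraMap ℝ (coverGrading (branchForm Q₁ Q₂ Q₃) 0))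

section chartLift

variable {S : Type*} [CommRing S] [Algebra ℝ S] (g : CoverRing (branchForm Q₁ Q₂ Q₃) →ₐ[ℝ] S)
  (hg : IsUnit (g D.den))

/-- The restriction of a map to the diagonal subring. -/
def diagMap : diagonal (coverBigrading (branchForm Q₁ Q₂ Q₃)) →+* S :=
  g.toRingHom.comp (diagonal (coverBigrading (branchForm Q₁ Q₂ Q₃))).val.toRingHom

theorem isUnit_diagMap (hg : IsUnit (g D.den)) : IsUnit (diagMap g D.diagDen) := hg

/-- The map on the chart induced by a map under which the denominator becomes invertible. -/
def chartLift : D.Chart →+* S :=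
  (IsLocalization.Away.lift (S := Localization (Submonoid.powers D.diagDen)) D.diagDen
    (D.isUnit_diagMap g hg)).comp (algebraMap D.Chart (Localization (Submonoid.powers D.diagDen)))

/-- The value on a fraction is stated without division, since the target is only a ring. -/
theorem chartLift_frac (n : ℕ) (a : CoverRing (branchForm Q₁ Q₂ Q₃))
    (ha : a ∈ coverBigrading (branchForm Q₁ Q₂ Q₃) (n • 4, n • 4)) :
    D.chartLift g hg (D.frac n a ha) * g D.den ^ n = g a := by
  have h : algebraMap D.Chart (Localization (Submonoid.powers D.diagDen)) (D.frac n a ha) *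
      algebraMap (diagonal (coverBigrading (branchForm Q₁ Q₂ Q₃))) _ D.diagDen ^ n =
        algebraMap (diagonal (coverBigrading (branchForm Q₁ Q₂ Q₃))) _
          ⟨a, mem_diagonal ha⟩ := by
    have hv : algebraMap D.Chart (Localization (Submonoid.powers D.diagDen)) (D.frac n a ha) =
        IsLocalization.mk' _ (⟨a, mem_diagonal ha⟩ : diagonal (coverBigrading _))
          (⟨D.diagDen ^ n, n, rfl⟩ : Submonoid.powers D.diagDen) :=
      Localization.mk_eq_mk'_apply _ _
    rw [hv, ← map_pow]
    exact IsLocalization.mk'_spec _ _ (⟨D.diagDen ^ n, n, rfl⟩ : Submonoid.powers D.diagDen)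
  have h' := congrArg (IsLocalization.Away.lift D.diagDen (D.isUnit_diagMap g hg)) h
  rw [map_mul, map_pow, IsLocalization.Away.lift_eq, IsLocalization.Away.lift_eq] at h'
  exact h'

theorem chartLift_chartScalar (c : ℝ) : D.chartLift g hg (D.chartScalar c) = algebraMap ℝ S c := by
  have h : algebraMap D.Chart (Localization (Submonoid.powers D.diagDen)) (D.chartScalar c) =
      algebraMap _ _ (algebraMap ℝ (diagonal (coverBigrading (branchForm Q₁ Q₂ Q₃))) c) :=
    (Localization.mk_one_eq_algebraMap _)
  rw [chartLift, RingHom.comp_apply, h, IsLocalization.Away.lift_eq]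
  exact g.commutes c

end chartLift

/-- The map from the chart to the ring parametrizing it. -/
def chartParam : D.Chart →+* D.LocRing := D.chartLift D.param D.isUnit_param_den

/-! ### Projection from the section: the inverse map -/

theorem coordT_mul_mem :
    coordT _ 1 * (coordX _ D.j ^ 2 * D.elemG * D.elemH) ∈
      coverBigrading (branchForm Q₁ Q₂ Q₃) (1 • 4, 1 • 4) :=
  SetLike.GradedMul.mul_mem (i := (1, 0)) (j := (3, 4)) (coordT_mem _ _)
    (SetLike.GradedMul.mul_mem (i := (1, 3)) (j := (2, 1))
      (SetLike.GradedMul.mul_mem (i := (0, 2)) (j := (1, 1))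
        (SetLike.pow_mem_graded (i := ((0, 1) : ℕ × ℕ)) 2 (coordX_mem _ _)) D.elemG_mem)
      D.elemH_mem)

/-- This is the numerator of `t₀ yᵢ / G` over the denominator `t₀ xⱼ² G H`. -/
theorem vecY_mul_mem (i : Fin 3) :
    D.vecY i * (coordT _ 0 ^ 2 * coordX _ D.j ^ 2 * D.elemH) ∈
      coverBigrading (branchForm Q₁ Q₂ Q₃) (1 • 4, 1 • 4) :=
  SetLike.GradedMul.mul_mem (i := (0, 1)) (j := (4, 3)) (D.vecY_mem i)
    (SetLike.GradedMul.mul_mem (i := (2, 2)) (j := (2, 1))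
      (SetLike.GradedMul.mul_mem (i := (2, 0)) (j := (0, 2))
        (SetLike.pow_mem_graded (i := ((1, 0) : ℕ × ℕ)) 2 (coordT_mem _ _))
        (SetLike.pow_mem_graded (i := ((0, 1) : ℕ × ℕ)) 2 (coordX_mem _ _)))
      D.elemH_mem)

/-- Projection pulls `U V` back to `xⱼ H² / (t₀ G³)`; this is the numerator of the inverse over the
square of the denominator. -/
theorem unit_num_mem :
    coordT _ 0 ^ 3 * coordX _ D.j ^ 3 * D.elemG ^ 5 ∈
      coverBigrading (branchForm Q₁ Q₂ Q₃) (2 • 4, 2 • 4) :=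
  SetLike.GradedMul.mul_mem (i := (3, 3)) (j := (5, 5))
    (SetLike.GradedMul.mul_mem (i := (3, 0)) (j := (0, 3))
      (SetLike.pow_mem_graded (i := ((1, 0) : ℕ × ℕ)) 3 (coordT_mem _ _))
      (SetLike.pow_mem_graded (i := ((0, 1) : ℕ × ℕ)) 3 (coordX_mem _ _)))
    (SetLike.pow_mem_graded (i := ((1, 1) : ℕ × ℕ)) 5 D.elemG_mem)

/-- The images of the parameters in the chart: `T = t₁ / t₀` and `m = t₀ y / G`. -/
def chartPoint (i : Fin 3) : D.Chart :=
  if i = D.j then D.frac 1 _ D.coordT_mul_mem else D.frac 1 _ (D.vecY_mul_mem i)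

/-- Projection from the section over `p`, on polynomials. -/
def proj : MvPolynomial (Fin 3) ℝ →+* D.Chart := eval₂Hom D.chartScalar D.chartPoint

/-! ### Verification of the inverse maps in the field of fractions -/

section FractionField

/-- The inclusion of the coordinate ring in its field of fractions. -/
def toFrac : CoverRing (branchForm Q₁ Q₂ Q₃) →ₐ[ℝ]
    FractionRing (CoverRing (branchForm Q₁ Q₂ Q₃)) :=
  IsScalarTower.toAlgHom ℝ _ _

theorem toFrac_injective : Function.Injective (toFrac (Q₁ := Q₁) (Q₂ := Q₂) (Q₃ := Q₃)) :=
  IsFractionRing.injective _ _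

theorem toFrac_den : toFrac D.den =
    toFrac (coordT _ 0) * toFrac (coordX _ D.j) ^ 2 * toFrac D.elemG * toFrac D.elemH := by
  simp only [den, map_mul, map_pow]

theorem toFrac_den_ne_zero : toFrac D.den ≠ 0 := by
  rw [Ne, map_eq_zero_iff _ toFrac_injective]
  exact D.den_ne_zero

variable [IsDomain (CoverRing (branchForm Q₁ Q₂ Q₃))]

theorem toFrac_factors_ne_zero : toFrac (coordT (branchForm Q₁ Q₂ Q₃) 0) ≠ 0 ∧
    toFrac (coordX (branchForm Q₁ Q₂ Q₃) D.j) ≠ 0 ∧ toFrac D.elemG ≠ 0 ∧ toFrac D.elemH ≠ 0 := by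
  have h := D.toFrac_den_ne_zero
  rw [toFrac_den] at h
  simp only [ne_eq, mul_eq_zero, not_or, pow_eq_zero_iff two_ne_zero] at h
  tauto

/-- The chart embeds in the field of fractions of the bigraded ring. -/
def chartToFrac : D.Chart →+* FractionRing (CoverRing (branchForm Q₁ Q₂ Q₃)) :=
  D.chartLift toFrac (Ne.isUnit D.toFrac_den_ne_zero)

theorem chartToFrac_frac (n a ha) :
    D.chartToFrac (D.frac n a ha) = toFrac a / toFrac D.den ^ n := by
  rw [eq_div_iff (pow_ne_zero _ D.toFrac_den_ne_zero)]
  exact D.chartLift_frac _ _ n a ha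

theorem chartToFrac_injective : Function.Injective D.chartToFrac := by
  rw [injective_iff_map_eq_zero]
  intro w hw
  obtain ⟨n, a, ha, rfl⟩ := D.exists_eq_frac w
  rw [chartToFrac_frac, div_eq_zero_iff, map_eq_zero_iff _ toFrac_injective] at hw
  obtain rfl := hw.resolve_right (pow_ne_zero _ D.toFrac_den_ne_zero)
  exact mk_eq_zero_of_num _ rfl

/-- The projection from the section, composed with the inclusion in the field of fractions. -/
def projFrac : MvPolynomial (Fin 3) ℝ →ₐ[ℝ] FractionRing (CoverRing (branchForm Q₁ Q₂ Q₃)) :=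
  aeval fun i => if i = D.j then toFrac (coordT _ 1) / toFrac (coordT _ 0) else
    toFrac (coordT _ 0) / toFrac D.elemG * toFrac (D.vecY i)

theorem chartToFrac_proj (P : MvPolynomial (Fin 3) ℝ) :
    D.chartToFrac (D.proj P) = D.projFrac P := by
  have h : D.chartToFrac.comp D.proj = D.projFrac.toRingHom := by
    obtain ⟨h0, h1, h2, h3⟩ := D.toFrac_factors_ne_zero
    refine MvPolynomial.ringHom_ext (fun c => ?_) (fun i => ?_)
    · simp only [proj, RingHom.comp_apply, coe_eval₂Hom, eval₂_C]
      exact (D.chartLift_chartScalar _ _ c).trans (D.projFrac.commutes c).symm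
    · simp only [proj, RingHom.comp_apply, coe_eval₂Hom, eval₂_X, chartPoint, projFrac,
        AlgHom.toRingHom_eq_coe, RingHom.coe_coe, aeval_X]
      split_ifs
      · rw [chartToFrac_frac, toFrac_den]
        simp only [map_mul, map_pow]
        field_simp
      · rw [chartToFrac_frac, toFrac_den]
        simp only [map_mul, map_pow]
        field_simp
  exact congrArg (fun φ => φ P) h

theorem projFrac_polyT : (fun i => D.projFrac (D.polyT i)) =
    (toFrac (coordT (branchForm Q₁ Q₂ Q₃) 0))⁻¹ • fun i => toFrac (coordT _ i) := by
  obtain ⟨h0, -⟩ := D.toFrac_factors_ne_zero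
  funext i
  fin_cases i
  · simp [polyT, h0]
  · simp [polyT, projFrac, div_eq_inv_mul]

theorem projFrac_polyM : (fun i => D.projFrac (D.polyM i)) =
    (toFrac (coordT _ 0) / toFrac D.elemG) • fun i => toFrac (D.vecY i) := by
  funext i
  by_cases hi : i = D.j
  -- The coordinate `yⱼ = xⱼ - xⱼ pⱼ` vanishes because `pⱼ = 1`, in agreement with `mⱼ = 0`.
  · have h : D.vecY D.j = 0 := by simp [vecY, realVector, D.p_j]
    simp [polyM, hi, h]
  · simp [polyM, hi, projFrac]

/-- With `m = t₀ y / G`, the value of `1 - F(m)` is `(G² - F(y)) / G²`, and `elemG_sq_sub` factors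
the numerator. -/
theorem projFrac_polyU : D.projFrac D.polyU =
    toFrac (coordX _ D.j) * toFrac D.elemH / toFrac D.elemG ^ 2 := by
  obtain ⟨h0, h1, h2, h3⟩ := D.toFrac_factors_ne_zero
  have h := congrArg toFrac D.elemG_sq_sub
  rw [map_sub, map_mul, map_pow, map_formValue] at h
  rw [polyU, map_sub, map_one, map_formValue, projFrac_polyT, projFrac_polyM, formValue_smul,
    formValue_smul_left, ← h]
  field_simp

theorem projFrac_polyV : D.projFrac D.polyV =
    toFrac D.elemH / (toFrac (coordT _ 0) * toFrac D.elemG) := by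
  obtain ⟨h0, h1, h2, h3⟩ := D.toFrac_factors_ne_zero
  rw [polyV, map_sub, map_mul, map_formPolar, map_linearForm, projFrac_polyT, projFrac_polyM,
    formPolar_smul, formPolar_smul_left, linearForm_smul, map_realVector, elemH, map_sub, map_mul,
    map_mul, map_formPolar, map_realVector, lam, map_linearForm, map_ofNat, map_ofNat]
  field_simp

/-- The chart embeds in the field of fractions, where the explicit inverse can be checked. -/
theorem isUnit_proj : IsUnit (D.proj (D.polyU * D.polyV)) := by
  refine IsUnit.of_mul_eq_one (D.frac 2 _ D.unit_num_mem) (D.chartToFrac_injective ?_)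
  obtain ⟨h0, h1, h2, h3⟩ := D.toFrac_factors_ne_zero
  rw [map_mul, chartToFrac_proj, chartToFrac_frac, map_mul, projFrac_polyU, projFrac_polyV, map_one,
    toFrac_den]
  simp only [map_mul, map_pow]
  field_simp

/-- Projection from the section over `p`, from the chart to an open subset of `𝔸³`. -/
def projLoc : D.LocRing →+* D.Chart :=
  IsLocalization.Away.lift (D.polyU * D.polyV) D.isUnit_proj

theorem projLoc_toLoc (P : MvPolynomial (Fin 3) ℝ) : D.projLoc (D.toLoc P) = D.proj P :=
  IsLocalization.Away.lift_eq _ _ _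

theorem chartParam_comp_projLoc : D.chartParam.comp D.projLoc = RingHom.id _ := by
  refine IsLocalization.ringHom_ext (Submonoid.powers (D.polyU * D.polyV)) ?_
  refine MvPolynomial.ringHom_ext (fun c => ?_) (fun i => ?_)
  · change D.chartParam (D.projLoc (D.toLoc (C c))) = D.toLoc (C c)
    rw [projLoc_toLoc, proj, coe_eval₂Hom, eval₂_C]
    exact (D.chartLift_chartScalar _ _ c).trans (D.toLoc.commutes c).symm
  · change D.chartParam (D.projLoc (D.toLoc (X i))) = D.toLoc (X i)
    rw [projLoc_toLoc, proj, coe_eval₂Hom, eval₂_X]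
    -- Multiplying by the image of the denominator reduces the check on generators to a comparison
    -- of numerators.
    refine D.isUnit_param_den.mul_right_cancel ?_
    rw [chartPoint]
    split_ifs with hi
    · have h := D.chartLift_frac _ D.isUnit_param_den 1 _ D.coordT_mul_mem
      rw [pow_one] at h
      refine h.trans ?_
      simp only [den, map_mul, map_pow, param_coordT, locT, polyT, hi]
      simp
    · have h := D.chartLift_frac _ D.isUnit_param_den 1 _ (D.vecY_mul_mem i)
      rw [pow_one] at h
      refine h.trans ?_
      simp only [den, map_mul, map_pow, param_coordT_zero, param_vecY, locM, polyM, hi,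
        param_elemG, if_false]
      ring

/-- The inclusion of the parametrizing ring in the field of fractions. -/
def locToFrac : D.LocRing →ₐ[ℝ] FractionRing (CoverRing (branchForm Q₁ Q₂ Q₃)) where
  toRingHom := D.chartToFrac.comp D.projLoc
  commutes' c := by
    rw [← D.toLoc.commutes c]
    change D.chartToFrac (D.projLoc _) = _
    rw [projLoc_toLoc, chartToFrac_proj, AlgHom.commutes]

theorem locToFrac_toLoc (P : MvPolynomial (Fin 3) ℝ) : D.locToFrac (D.toLoc P) = D.projFrac P := by
  rw [← chartToFrac_proj, ← projLoc_toLoc]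
  rfl

theorem locToFrac_mu :
    D.locToFrac D.mu = toFrac D.elemG / (toFrac (coordT _ 0) * toFrac (coordX _ D.j)) := by
  obtain ⟨h0, h1, h2, h3⟩ := D.toFrac_factors_ne_zero
  have h := congrArg D.locToFrac D.mu_mul
  rw [map_mul, locToFrac_toLoc, locToFrac_toLoc, projFrac_polyU, projFrac_polyV] at h
  field_simp at h ⊢
  exact h

/-- The composite sends the coordinates to `t / t₀`, `x / xⱼ` and `z / (t₀ xⱼ)`. It is thus the
inclusion rescaled by the torus element `(t₀⁻¹, xⱼ⁻¹)`, so only the bidegree matters. -/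
theorem locToFrac_param {n : ℕ} {a : CoverRing (branchForm Q₁ Q₂ Q₃)}
    (ha : a ∈ coverBigrading (branchForm Q₁ Q₂ Q₃) (n, n)) :
    D.locToFrac (D.param a) =
      (toFrac (coordT _ 0))⁻¹ ^ n * (toFrac (coordX _ D.j))⁻¹ ^ n * toFrac a := by
  obtain ⟨h0, h1, h2, h3⟩ := D.toFrac_factors_ne_zero
  have hT (i : Fin 2) : D.locToFrac (D.locT i) =
      (toFrac (coordT (branchForm Q₁ Q₂ Q₃) 0))⁻¹ * toFrac (coordT _ i) :=
    (D.locToFrac_toLoc _).trans (congrFun D.projFrac_polyT i)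
  refine map_eq_of_scale (toFrac (coordT _ 0))⁻¹ (toFrac (coordX _ D.j))⁻¹ toFrac
    (D.locToFrac.comp D.param) ?_ ha
  rintro (_ | i | i)
  · change D.locToFrac (D.param (coordZ _)) = _ ^ 1 * _ ^ 1 * toFrac (coordZ _)
    have hlam : D.locToFrac (linearForm D.c D.locT) =
        (toFrac (coordT (branchForm Q₁ Q₂ Q₃) 0))⁻¹ * toFrac D.lam := by
      rw [lam, map_linearForm, map_linearForm, ← linearForm_smul]
      exact congrArg _ (funext hT)
    rw [param_coordZ, map_add, hlam, locToFrac_mu, elemG, map_sub, map_mul]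
    field_simp
    ring
  · change D.locToFrac (D.param (coordT _ i)) = _ ^ 1 * _ ^ 0 * toFrac (coordT _ i)
    rw [param_coordT, hT, pow_one, pow_zero, mul_one]
  · change D.locToFrac (D.param (coordX _ i)) = _ ^ 0 * _ ^ 1 * toFrac (coordX _ i)
    have hM : D.locToFrac (D.locM i) = toFrac (coordT _ 0) / toFrac D.elemG * toFrac (D.vecY i) :=
      (D.locToFrac_toLoc _).trans (congrFun D.projFrac_polyM i)
    rw [param_coordX, map_add, map_mul, AlgHom.commutes, locToFrac_mu, hM, vecY, map_sub, map_mul,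
      realVector, AlgHom.commutes]
    field_simp
    ring

/-- The numerator and the denominator of a fraction of degree zero are rescaled by the same factor,
so the fraction is unchanged. -/
theorem projLoc_comp_chartParam : D.projLoc.comp D.chartParam = RingHom.id _ := by
  refine RingHom.ext fun w => D.chartToFrac_injective ?_
  obtain ⟨n, a, ha, rfl⟩ := D.exists_eq_frac w
  obtain ⟨h0, h1, h2, h3⟩ := D.toFrac_factors_ne_zero
  change D.locToFrac (D.chartParam _) = D.chartToFrac (D.frac n a ha)
  have h := congrArg D.locToFrac (D.chartLift_frac _ D.isUnit_param_den n a ha)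
  rw [map_mul, map_pow, D.locToFrac_param D.den_mem, D.locToFrac_param ha] at h
  rw [chartToFrac_frac, eq_div_iff (pow_ne_zero _ D.toFrac_den_ne_zero)]
  rw [mul_pow, mul_pow, ← pow_mul, ← pow_mul, smul_eq_mul, mul_comm n 4, ← mul_assoc, ← mul_assoc,
    mul_right_comm, mul_comm] at h
  -- The common factor `(t₀ xⱼ)⁻⁴ⁿ`, coming from the bidegree `(4n, 4n)` of numerator and
  -- denominator.
  have hc : (toFrac (coordT (branchForm Q₁ Q₂ Q₃) 0))⁻¹ ^ (4 * n) *
      (toFrac (coordX (branchForm Q₁ Q₂ Q₃) D.j))⁻¹ ^ (4 * n) ≠ 0 :=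
    mul_ne_zero (pow_ne_zero _ (inv_ne_zero h0)) (pow_ne_zero _ (inv_ne_zero h1))
  refine mul_left_cancel₀ hc ?_
  rw [← h, chartParam]
  ring

/-- The chart of the double cover is an open subset of `𝔸³`. -/
def chartEquiv : D.Chart ≃+* D.LocRing :=
  RingEquiv.ofRingHom D.chartParam D.projLoc D.chartParam_comp_projLoc D.projLoc_comp_chartParam

theorem chartEquiv_chartScalar (c : ℝ) : D.chartEquiv (D.chartScalar c) = algebraMap ℝ _ c :=
  D.chartLift_chartScalar _ D.isUnit_param_den c

end FractionField

end LiftedPoint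

/-! ### Irreducibility of the double cover -/

/-- A monic quadratic polynomial in `z` without roots over a domain is irreducible, hence prime,
because polynomial rings over `ℝ` are factorial. -/
theorem isDomain_coverRing (F : BranchForm) (h : ∀ G : MvPolynomial BaseVar ℝ, G ^ 2 ≠ F.1) :
    IsDomain (CoverRing F) := by
  have hm : (Polynomial.X ^ 2 - Polynomial.C F.1 : Polynomial (MvPolynomial BaseVar ℝ)).Monic :=
    Polynomial.monic_X_pow_sub_C _ two_ne_zero
  have hd : (Polynomial.X ^ 2 - Polynomial.C F.1 :
      Polynomial (MvPolynomial BaseVar ℝ)).natDegree = 2 :=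
    Polynomial.natDegree_X_pow_sub_C
  have hirr : Irreducible
      (Polynomial.X ^ 2 - Polynomial.C F.1 : Polynomial (MvPolynomial BaseVar ℝ)) := by
    rw [hm.irreducible_iff_roots_eq_zero_of_degree_le_three hd.ge (by omega)]
    refine Multiset.eq_zero_of_forall_notMem fun G hG => h G ?_
    have := (Polynomial.mem_roots'.1 hG).2
    rwa [Polynomial.IsRoot, Polynomial.eval_sub, Polynomial.eval_pow, Polynomial.eval_X,
      Polynomial.eval_C, sub_eq_zero] at this
  have hren (P : MvPolynomial BaseVar ℝ) :
      optionEquivLeft ℝ BaseVar (rename some P) = Polynomial.C P := by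
    have : ((optionEquivLeft ℝ BaseVar).toAlgHom.comp (rename some)) =
        Polynomial.CAlgHom := by
      ext i
      simp
    exact congrArg (fun φ => φ P) this
  have hprime : Prime (X none ^ 2 - rename some F.1 : MvPolynomial Var ℝ) := by
    rw [← MulEquiv.prime_iff (optionEquivLeft ℝ BaseVar)]
    rw [map_sub, map_pow, optionEquivLeft_X_none, hren]
    exact hirr.prime
  have : (coverIdeal F).IsPrime := (Ideal.span_singleton_prime hprime.ne_zero).2 hprime
  exact Ideal.Quotient.isDomain _

/-- A square of degree at most two is the square of a linear polynomial, so its discriminant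
vanishes. -/
theorem mul_eq_sq_of_sq_eq {α β γ : ℝ} {g : Polynomial ℝ}
    (h : g ^ 2 = Polynomial.C α + Polynomial.C (2 * β) * Polynomial.X +
      Polynomial.C γ * Polynomial.X ^ 2) : α * γ - β ^ 2 = 0 := by
  have hdeg : g.natDegree ≤ 1 := by
    have h1 : (g ^ 2).natDegree ≤ 2 := by
      rw [h]
      compute_degree
    rw [Polynomial.natDegree_pow] at h1
    omega
  obtain ⟨b, a, rfl⟩ := Polynomial.exists_eq_X_add_C_of_natDegree_le_one hdeg
  have e : (Polynomial.C b * Polynomial.X + Polynomial.C a) ^ 2 = Polynomial.C (a ^ 2) +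
      Polynomial.C (2 * (a * b)) * Polynomial.X + Polynomial.C (b ^ 2) * Polynomial.X ^ 2 := by
    simp only [map_mul, map_pow, map_ofNat]
    ring
  rw [e] at h
  have h0 := congrArg (fun q => Polynomial.coeff q 0) h
  have h1 := congrArg (fun q => Polynomial.coeff q 1) h
  have h2 := congrArg (fun q => Polynomial.coeff q 2) h
  simp only [Polynomial.coeff_add, Polynomial.coeff_C_mul, Polynomial.coeff_C,
    Polynomial.coeff_X_pow, Polynomial.coeff_X] at h0 h1 h2
  norm_num at h0 h1 h2
  rw [← h0, ← h1, ← h2]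
  ring

/-- If `F` were a square, so would be its restriction to `ℙ¹ × {v}` for every real `v`. Its
discriminant, the value of the quartic at `v`, would then always vanish, and the zero quartic is not
smooth. -/
theorem branchForm_ne_sq (Q₁ Q₂ Q₃ : TernaryQuadraticForm)
    (hsmooth : IsSmoothPlaneCurve (quartic Q₁ Q₂ Q₃)) (G : MvPolynomial BaseVar ℝ) :
    G ^ 2 ≠ (branchForm Q₁ Q₂ Q₃).1 := by
  intro hG
  have h0 : quartic Q₁ Q₂ Q₃ = 0 := by
    refine MvPolynomial.funext fun v => ?_
    have h := congrArg (aeval (Sum.elim ![1, Polynomial.X] fun i => Polynomial.C (v i))) hG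
    rw [map_pow, aeval_branchForm] at h
    have hv (Q : TernaryQuadraticForm) :
        aeval (fun i => Polynomial.C (v i)) Q.1 = Polynomial.C (eval v Q.1) := by
      rw [← coe_aeval_eq_eval]
      exact aeval_algebraMap_apply _ _ _
    simp only [formValue, Sum.elim_inl, Sum.elim_inr, hv] at h
    rw [quartic, map_sub, map_mul, map_pow, map_zero]
    refine mul_eq_sq_of_sq_eq (h.trans ?_)
    simp only [Matrix.cons_val_zero, Matrix.cons_val_one, map_mul, map_ofNat]
    ring
  -- Any nonzero vector is a singular point of the zero form; `(1, 1, 1)` is used.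
  obtain ⟨i, hi⟩ := hsmooth 1 one_ne_zero (by rw [h0, map_zero])
  rw [h0, map_zero, map_zero] at hi
  exact hi rfl

/-! ### Real points of the discriminant curve -/

theorem exists_sq_or_neg_sq {α β γ : ℝ} (h : α * γ = β ^ 2) :
    (∃ c : Fin 2 → ℝ, α = c 0 ^ 2 ∧ β = c 0 * c 1 ∧ γ = c 1 ^ 2) ∨
      ∃ c : Fin 2 → ℝ, -α = c 0 ^ 2 ∧ β = c 0 * c 1 ∧ -γ = c 1 ^ 2 := by
  have key {α β γ : ℝ} (h : α * γ = β ^ 2) (hα : 0 ≤ α) (hγ : 0 ≤ γ) :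
      ∃ c : Fin 2 → ℝ, α = c 0 ^ 2 ∧ β = c 0 * c 1 ∧ γ = c 1 ^ 2 := by
    have hs : √α * √γ = |β| := by rw [← Real.sqrt_mul hα, h, Real.sqrt_sq_eq_abs]
    -- The sign of `β` is put into `s`.
    rcases le_total 0 β with hβ | hβ
    · refine ⟨![√α, √γ], (Real.sq_sqrt hα).symm, ?_, (Real.sq_sqrt hγ).symm⟩
      simp [hs, abs_of_nonneg hβ]
    · refine ⟨![√α, -√γ], (Real.sq_sqrt hα).symm, ?_, ?_⟩
      · simp [hs, abs_of_nonpos hβ]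
      · simp [Real.sq_sqrt hγ]
  by_cases hp : 0 ≤ α ∧ 0 ≤ γ
  · exact Or.inl (key h hp.1 hp.2)
  -- Since `α γ ≥ 0`, if one of `α`, `γ` is negative then both are nonpositive.
  · refine Or.inr (key (by linarith) ?_ ?_)
    · by_contra! hα
      exact hp ⟨by linarith, by nlinarith [sq_nonneg β]⟩
    · by_contra! hγ
      exact hp ⟨by nlinarith [sq_nonneg β], by linarith⟩

theorem eval_smul (Q : TernaryQuadraticForm) (c : ℝ) (v : Fin 3 → ℝ) :
    eval (c • v) Q.1 = c ^ 2 * eval v Q.1 := by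
  rw [← coe_aeval_eq_eval, ← coe_aeval_eq_eval]
  exact aeval_smul Q c v

theorem exists_normalized_realPoint {Q₁ Q₂ Q₃ : TernaryQuadraticForm}
    (h : (realPoints (quartic Q₁ Q₂ Q₃)).Nonempty) :
    ∃ (p : Fin 3 → ℝ) (j : Fin 3), p j = 1 ∧ eval p Q₁.1 * eval p Q₃.1 = eval p Q₂.1 ^ 2 := by
  obtain ⟨x, hx⟩ := h
  obtain ⟨j, hj⟩ := Function.ne_iff.1 x.rep_nonzero
  have hx' : eval x.rep (Q₁.1 * Q₃.1 - Q₂.1 ^ 2) = 0 := hx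
  rw [map_sub, map_mul, map_pow, sub_eq_zero] at hx'
  refine ⟨(x.rep j)⁻¹ • x.rep, j, inv_mul_cancel₀ hj, ?_⟩
  simp only [eval_smul]
  linear_combination (x.rep j)⁻¹ ^ 4 * hx'

/-- The quartic is singular where all three forms vanish. -/
theorem false_of_common_zero {Q₁ Q₂ Q₃ : TernaryQuadraticForm}
    (hsmooth : IsSmoothPlaneCurve (quartic Q₁ Q₂ Q₃)) {p : Fin 3 → ℝ} (hp : p ≠ 0)
    (h₁ : eval p Q₁.1 = 0) (h₂ : eval p Q₂.1 = 0) (h₃ : eval p Q₃.1 = 0) : False := by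
  have hC (P : MvPolynomial (Fin 3) ℝ) :
      aeval (fun i => algebraMap ℝ ℂ (p i)) P = algebraMap ℝ ℂ (eval p P) := by
    rw [← coe_aeval_eq_eval]
    exact aeval_algebraMap_apply _ _ _
  obtain ⟨i, hi⟩ := hsmooth (fun i => algebraMap ℝ ℂ (p i))
    (fun h => hp (funext fun i => by simpa using congrFun h i)) (by
      rw [hC, quartic]
      simp [h₁, h₂, h₃])
  rw [hC, quartic] at hi
  -- The quartic is quadratic in the `Qᵢ`, so each term of its partial derivatives retains a factor
  -- `Qᵢ`.
  simp [h₁, h₂, h₃, Derivation.leibniz, Derivation.leibniz_pow] at hi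

theorem twistedBranchForm_eq (Q₁ Q₂ Q₃ : TernaryQuadraticForm) :
    twistedBranchForm Q₁ Q₂ Q₃ = branchForm (-Q₁) Q₂ (-Q₃) := by
  refine Subtype.ext ?_
  simp only [twistedBranchForm, branchForm, NegMemClass.coe_neg, map_neg]
  ring

theorem quartic_neg (Q₁ Q₂ Q₃ : TernaryQuadraticForm) :
    quartic (-Q₁) Q₂ (-Q₃) = quartic Q₁ Q₂ Q₃ := by
  simp only [quartic, NegMemClass.coe_neg]
  ring

/-! ### Rationality of the double cover -/

/-- A nonempty basic open subset of the `Proj` of a graded domain is dense. -/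
theorem dense_basicOpen {R A : Type} [CommRing R] [CommRing A] [Algebra R A] [IsDomain A]
    (𝒜 : ℕ → Submodule R A) [GradedAlgebra 𝒜] {f : A} {m : ℕ} (hf : f ∈ 𝒜 m) (hm : 0 < m)
    (h0 : f ≠ 0) : Dense (Proj.basicOpen 𝒜 f : Set (Proj 𝒜)) := by
  -- The nonzero element `f` of positive degree shows that the zero ideal is a point of `Proj`; this
  -- generic point lies in every nonempty open set.
  have hirr : ¬ HomogeneousIdeal.irrelevant 𝒜 ≤ ⊥ := fun h => by
    have : f ∈ HomogeneousIdeal.irrelevant 𝒜 := by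
      rw [HomogeneousIdeal.mem_irrelevant_iff, GradedRing.proj_apply,
        DirectSum.decompose_of_mem_ne 𝒜 hf hm.ne']
    exact h0 (h this)
  let η : Proj 𝒜 := (⟨⊥, Ideal.isPrime_bot, hirr⟩ : ProjectiveSpectrum 𝒜)
  have hη (g : A) (hg : g ≠ 0) : η ∈ Proj.basicOpen 𝒜 g := fun h => hg h
  refine dense_iff_inter_open.2 fun U hU ⟨x, hx⟩ => ⟨η, ?_, hη f h0⟩
  obtain ⟨V, ⟨-, ⟨g, rfl⟩, rfl⟩, hxV, hVU⟩ :=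
    (Proj.isBasis_basicOpen 𝒜).exists_subset_of_mem_open hx hU
  refine hVU (hη g fun hg => ?_)
  rw [hg, Proj.basicOpen_zero] at hxV
  exact hxV

theorem isDominant_awayι {R A : Type} [CommRing R] [CommRing A] [Algebra R A] [IsDomain A]
    (𝒜 : ℕ → Submodule R A) [GradedAlgebra 𝒜] {f : A} {m : ℕ} (hf : f ∈ 𝒜 m) (hm : 0 < m)
    (h0 : f ≠ 0) : IsDominant (Proj.awayι 𝒜 f hf hm) := by
  refine ⟨?_⟩
  have := dense_basicOpen 𝒜 hf hm h0
  rw [← Proj.opensRange_awayι 𝒜 f hf hm] at this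
  exact this

theorem isDominant_SpecMap {R S : Type} [CommRing R] [CommRing S] [Algebra R S]
    (h : Function.Injective (algebraMap R S)) :
    IsDominant (Spec.map (CommRingCat.ofHom (algebraMap R S))) := by
  refine ⟨(PrimeSpectrum.denseRange_comap_iff_ker_le_nilRadical (algebraMap R S)).2 ?_⟩
  rw [(RingHom.injective_iff_ker_eq_bot _).1 h]
  exact bot_le

namespace LiftedPoint

variable {Q₁ Q₂ Q₃ : TernaryQuadraticForm} (D : LiftedPoint Q₁ Q₂ Q₃)

/-- Inverting a nonzero polynomial gives a dense open subscheme of `𝔸³`. -/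
theorem birationalOver_affineSpace :
    Scheme.BirationalOver (Spec.map (CommRingCat.ofHom (algebraMap ℝ D.LocRing)))
      (𝔸(Fin 3; Spec (CommRingCat.of ℝ)) ↘ Spec (CommRingCat.of ℝ)) := by
  let f := Spec.map (CommRingCat.ofHom (algebraMap (MvPolynomial (Fin 3) ℝ) D.LocRing))
  have h1 : IsOpenImmersion f := IsOpenImmersion.of_isLocalization (D.polyU * D.polyV)
  have h2 : IsDominant f := isDominant_SpecMap
    (IsLocalization.injective _
      (powers_le_nonZeroDivisors_of_noZeroDivisors D.polyU_mul_polyV_ne_zero))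
  refine Scheme.Hom.birationalOver (f ≫ (AffineSpace.SpecIso (Fin 3) (CommRingCat.of ℝ)).inv) _ _ ?_
  rw [Category.assoc, AffineSpace.SpecIso_inv_over, ← Spec.map_comp]
  rfl

/-- The same ring is the coordinate ring of a basic open set of the cover, by `chartEquiv`. That set
is dense because the denominator is nonzero in a domain. -/
theorem birationalOver_doubleCover [IsDomain (CoverRing (branchForm Q₁ Q₂ Q₃))] :
    Scheme.BirationalOver (Spec.map (CommRingCat.ofHom (algebraMap ℝ D.LocRing)))
      (doubleCover.structureMap (branchForm Q₁ Q₂ Q₃)) := by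
  let e : CommRingCat.of D.Chart ≅ CommRingCat.of D.LocRing := D.chartEquiv.toCommRingCatIso
  let ι := Proj.awayι (coverGrading (branchForm Q₁ Q₂ Q₃)) D.diagDen D.diagDen_mem four_pos
  have : IsDominant ι := isDominant_awayι _ _ _ fun h => D.den_ne_zero (congrArg Subtype.val h)
  change Scheme.BirationalOver _ (Proj.toSpecZero (coverGrading (branchForm Q₁ Q₂ Q₃)) ≫
    Spec.map (CommRingCat.ofHom (algebraMap ℝ (coverGrading (branchForm Q₁ Q₂ Q₃) 0))))
  refine Scheme.Hom.birationalOver (Spec.map e.hom ≫ ι) _ _ ?_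
  rw [Category.assoc, Proj.awayι_toSpecZero_assoc, ← Spec.map_comp, ← Spec.map_comp]
  congr 1
  ext c
  exact D.chartEquiv_chartScalar c

theorem isRationalThreefold (D : LiftedPoint Q₁ Q₂ Q₃)
    (hsmooth : IsSmoothPlaneCurve (quartic Q₁ Q₂ Q₃)) :
    IsRationalThreefold (doubleCover.structureMap (branchForm Q₁ Q₂ Q₃)) :=
  have := isDomain_coverRing _ (branchForm_ne_sq Q₁ Q₂ Q₃ hsmooth)
  D.birationalOver_doubleCover.symm.trans D.birationalOver_affineSpace

end LiftedPoint

theorem isRationalThreefold_of_eval {Q₁ Q₂ Q₃ : TernaryQuadraticForm}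
    (hsmooth : IsSmoothPlaneCurve (quartic Q₁ Q₂ Q₃)) {p : Fin 3 → ℝ} {j : Fin 3} (hj : p j = 1)
    {c : Fin 2 → ℝ} (h₁ : eval p Q₁.1 = c 0 ^ 2) (h₂ : eval p Q₂.1 = c 0 * c 1)
    (h₃ : eval p Q₃.1 = c 1 ^ 2) :
    IsRationalThreefold (doubleCover.structureMap (branchForm Q₁ Q₂ Q₃)) := by
  have hp : p ≠ 0 := fun h => by simp [h] at hj
  -- If `r = s = 0`, all three forms vanish at `p`, which is then a singular point of the quartic.
  have hc : c ≠ 0 := fun h => false_of_common_zero hsmooth hp (by simp [h₁, h]) (by simp [h₂, h])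
    (by simp [h₃, h])
  exact LiftedPoint.isRationalThreefold ⟨p, j, c, hj, hc, h₁, h₂, h₃⟩ hsmooth

end DoubleCover

end

theorem corollary2p11 (Q₁ Q₂ Q₃ : DoubleCover.TernaryQuadraticForm)
    (hsmooth : DoubleCover.IsSmoothPlaneCurve (DoubleCover.quartic Q₁ Q₂ Q₃))
    (hreal : (DoubleCover.realPoints (DoubleCover.quartic Q₁ Q₂ Q₃)).Nonempty) :
    DoubleCover.IsRationalThreefold
        (DoubleCover.doubleCover.structureMap (DoubleCover.branchForm Q₁ Q₂ Q₃)) ∨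
      DoubleCover.IsRationalThreefold
        (DoubleCover.doubleCover.structureMap (DoubleCover.twistedBranchForm Q₁ Q₂ Q₃)) := by
  obtain ⟨p, j, hj, hp⟩ := DoubleCover.exists_normalized_realPoint hreal
  rcases DoubleCover.exists_sq_or_neg_sq hp with ⟨c, h₁, h₂, h₃⟩ | ⟨c, h₁, h₂, h₃⟩
  · exact Or.inl (DoubleCover.isRationalThreefold_of_eval hsmooth hj h₁ h₂ h₃)
  · right
    -- The twist is the cover attached to `(-Q₁, Q₂, -Q₃)`, which has the same quartic, so the
    -- untwisted case applies.
    rw [DoubleCover.twistedBranchForm_eq]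
    rw [← DoubleCover.quartic_neg] at hsmooth
    refine DoubleCover.isRationalThreefold_of_eval hsmooth hj (c := c) ?_ h₂ ?_
    · rw [NegMemClass.coe_neg, map_neg, h₁]
    · rw [NegMemClass.coe_neg, map_neg, h₃]
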